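/- Let $G$ be a finite simple graph (no loops, no multiple edges). Let $\Delta(G)$ be its maximum degree, let $\chi'(G)$ be its edge-chromatic number, i.e. the least number of colors in an assignment of colors to the edges of $G$ such that distinct edges with a common endpoint receive distinct colors, and let $$\mathrm{mad}(G)=\max_{H}\frac{2|E(H)|}{|V(H)|}$$ be its maximum average degree, the maximum being over all subgraphs $H$ of $G$ with at least one vertex. If $\mathrm{mad}(G)<6$ and $\Delta(G)\ge 8$, then $\chi'(G)=\Delta(G)$ (that is, $G$ is Class 1). -/

import Mathlib

namespace SimpleGraph

/-- The maximum average degree `mad(G)`: the maximum of `2|E(H)| / |V(H)|` over all subgraphs `H`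
of `G` with at least one vertex (a genuine maximum for finite graphs with a vertex, see
`isGreatest_mad`). -/
noncomputable def mad {V : Type*} (G : SimpleGraph V) : ℝ :=
  sSup {d : ℝ | ∃ H : G.Subgraph, H.verts.Nonempty ∧
    d = 2 * (H.edgeSet.ncard : ℝ) / (H.verts.ncard : ℝ)}

theorem isGreatest_mad {V : Type*} [Finite V] [Nonempty V] (G : SimpleGraph V) :
    IsGreatest {d : ℝ | ∃ H : G.Subgraph, H.verts.Nonempty ∧
      d = 2 * (H.edgeSet.ncard : ℝ) / (H.verts.ncard : ℝ)} G.mad := by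
  have hfin : Set.Finite {d : ℝ | ∃ H : G.Subgraph, H.verts.Nonempty ∧
      d = 2 * (H.edgeSet.ncard : ℝ) / (H.verts.ncard : ℝ)} := by
    refine (Set.finite_range fun H : G.Subgraph =>
      2 * (H.edgeSet.ncard : ℝ) / (H.verts.ncard : ℝ)).subset ?_
    rintro d ⟨H, -, rfl⟩
    exact ⟨H, rfl⟩
  have hne : Set.Nonempty {d : ℝ | ∃ H : G.Subgraph, H.verts.Nonempty ∧
      d = 2 * (H.edgeSet.ncard : ℝ) / (H.verts.ncard : ℝ)} :=
    ⟨_, ⊤, Set.univ_nonempty, rfl⟩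
  exact ⟨hne.csSup_mem hfin, fun d hd => le_csSup hfin.bddAbove hd⟩

/-- An assignment of colors to the edges is a proper edge-coloring if distinct edges with a
common endpoint receive distinct colors. -/
def IsProperEdgeColoring {V K : Type*} {G : SimpleGraph V} (c : G.EdgeLabeling K) : Prop :=
  ∀ e f : G.edgeSet, e ≠ f → (∃ v : V, v ∈ (e : Sym2 V) ∧ v ∈ (f : Sym2 V)) → c e ≠ c f

/-- The edge-chromatic number `χ'(G)`: the least number of colors in a proper edge-coloring
(`⊤` if no finite number suffices, which does not happen for finite graphs). -/
noncomputable def edgeChromaticNumber {V : Type*} (G : SimpleGraph V) : ℕ∞ :=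
  sInf {m : ℕ∞ | ∃ k : ℕ, m = (k : ℕ∞) ∧
    ∃ c : G.EdgeLabeling (Fin k), IsProperEdgeColoring c}

end SimpleGraph

/-! The edges at a vertex of maximum degree need distinct colors, so only the upper bound is
substantial. Put `k = Δ(G)` and suppose that `k` colors do not suffice; take a minimal uncolorable
subgraph `H`. By Vizing's adjacency lemma (`vizing_adjacency`), for each edge `xy` of `H` the vertex
`x` has at least `k + 1 - d(y)` neighbors of degree `k` other than `y`. Discharging
(`six_mul_card_le_sum_degree`) then gives average degree at least 6 on the non-isolated vertices of
`H`, against `mad(G) < 6`.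

The adjacency lemma comes from a multifan at `x` in a coloring of `H - xy`: recoloring and Kempe
swaps make the missing-color sets of `x` and of the fan vertices pairwise disjoint, and counting
colors on the fan edges finishes. -/

namespace SimpleGraph

/-! ### Multifans and Kempe chains -/

section Fan

variable {V K : Type*} {G : SimpleGraph V} {c : Sym2 V → K} {x y z : V} {α β : K}

/-- `c` restricts to a proper edge-coloring of `G`; its values off the edges of `G` are
irrelevant. -/
def IsEdgeProper (G : SimpleGraph V) (c : Sym2 V → K) : Prop :=
  ∀ u v w, G.Adj u v → G.Adj u w → c s(u, v) = c s(u, w) → v = w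

/-- The colors that do not appear on the edges of `G` at `v`. -/
def missing (G : SimpleGraph V) (c : Sym2 V → K) (v : V) : Set K :=
  {a | ∀ w, G.Adj v w → c s(v, w) ≠ a}

/-- The `n`-th layer of the multifan at `x` that starts at `y`. -/
def fanLayer (G : SimpleGraph V) (c : Sym2 V → K) (x y : V) : ℕ → Set V
  | 0 => {y}
  | n + 1 => {a | G.Adj x a ∧ ∃ b ∈ fanLayer G c x y n, c s(x, a) ∈ G.missing c b}

-- Two graphs are involved so that it serves both to recolor an edge (`H = G`) and to extend a
-- coloring over a deleted edge.
open Classical in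
theorem IsEdgeProper.update {H : SimpleGraph V} (hc : G.IsEdgeProper c)
    (hGH : ∀ u v, H.Adj u v → s(u, v) ≠ s(x, z) → G.Adj u v) (hx : α ∈ G.missing c x)
    (hz : α ∈ G.missing c z) : H.IsEdgeProper (Function.update c s(x, z) α) := by
  have key : ∀ u v w, s(u, v) = s(x, z) → H.Adj u w → s(u, w) ≠ s(x, z) → c s(u, w) ≠ α := by
    intro u v w hv huw hw
    rcases Sym2.eq_iff.1 hv with ⟨rfl, -⟩ | ⟨rfl, -⟩
    · exact hx _ (hGH _ _ huw hw)
    · exact hz _ (hGH _ _ huw hw)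
  intro u v w huv huw h
  by_cases hv : s(u, v) = s(x, z) <;> by_cases hw : s(u, w) = s(x, z)
  · exact Sym2.congr_right.1 (hv.trans hw.symm)
  · rw [Function.update_of_ne hw, hv, Function.update_self] at h
    exact (key u v w hv huw hw h.symm).elim
  · rw [Function.update_of_ne hv, hw, Function.update_self] at h
    exact (key u w v hw huv hv h).elim
  · rw [Function.update_of_ne hv, Function.update_of_ne hw] at h
    exact hc _ _ _ (hGH _ _ huv hv) (hGH _ _ huw hw) h

/-- If no proper coloring leaves a common color missing at `x` and `y`, then no vertex of the
multifan at `x` starting at `y` misses a color that is missing at `x`. -/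
theorem disjoint_missing_fanLayer
    (hno : ∀ c : Sym2 V → K, G.IsEdgeProper c → Disjoint (G.missing c x) (G.missing c y))
    (n : ℕ) : ∀ (c : Sym2 V → K), G.IsEdgeProper c → ∀ z ∈ G.fanLayer c x y n,
      Disjoint (G.missing c x) (G.missing c z) := by
  classical
  induction n using Nat.strong_induction_on with
  | _ n ih =>
    intro c hc z hz
    -- With `z` in no earlier layer, recoloring `xz` with `α` preserves those layers. It frees the
    -- old color of `xz` at `x`, a color that `w` in the previous layer also misses.
    by_cases hlow : ∃ m < n, z ∈ G.fanLayer c x y m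
    · obtain ⟨m, hm, hzm⟩ := hlow
      exact ih m hm c hc z hzm
    push Not at hlow
    cases n with
    | zero => rw [Set.mem_singleton_iff.1 hz]; exact hno c hc
    | succ n =>
      obtain ⟨hxz, w, hw, hwz⟩ := hz
      rw [Set.disjoint_left]
      intro α hαx hαz
      set c' := Function.update c s(x, z) α with hc'
      have hne : x ≠ z := hxz.ne
      have hmiss : ∀ b, b ≠ x → b ≠ z → G.missing c b ⊆ G.missing c' b := by
        intro b hbx hbz γ hγ a hba
        rw [hc', Function.update_of_ne]
        · exact hγ a hba
        · intro h
          rcases Sym2.eq_iff.1 h with ⟨h, -⟩ | ⟨h, -⟩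
          · exact hbx h
          · exact hbz h
      have hlayer : ∀ m ≤ n, G.fanLayer c x y m ⊆ G.fanLayer c' x y m := by
        intro m
        induction m with
        | zero => exact fun _ => subset_rfl
        | succ m ihm =>
          rintro hm a ⟨hxa, b, hb, hab⟩
          have haz : a ≠ z := by
            rintro rfl
            exact hlow (m + 1) (by omega) ⟨hxa, b, hb, hab⟩
          have hbz : b ≠ z := by rintro rfl; exact hlow m (by omega) hb
          have hbx : b ≠ x := by rintro rfl; exact hab a hxa rfl
          refine ⟨hxa, b, ihm (by omega) hb, ?_⟩
          have : c' s(x, a) = c s(x, a) := by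
            rw [hc', Function.update_of_ne]
            exact fun h => haz (Sym2.congr_right.1 h)
          rw [this]
          exact hmiss b hbx hbz hab
      have hwne : w ≠ z := by rintro rfl; exact hlow n (by omega) hw
      have hwx : w ≠ x := by rintro rfl; exact hwz z hxz rfl
      refine Set.disjoint_left.1
        (ih n (by omega) c' (hc.update (fun _ _ h _ => h) hαx hαz) w (hlayer n le_rfl hw))
        (?_ : c s(x, z) ∈ G.missing c' x) (hmiss w hwx hwne hwz)
      intro a hxa h
      by_cases haz : a = z
      · subst haz
        rw [hc', Function.update_self] at h
        exact hαx a hxa h.symm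
      · rw [hc', Function.update_of_ne fun h => haz (Sym2.congr_right.1 h)] at h
        exact haz (hc _ _ _ hxa hxz h)

/-- The subgraph of the edges colored `α` or `β`. -/
def kempe (G : SimpleGraph V) (c : Sym2 V → K) (α β : K) : SimpleGraph V where
  Adj u v := G.Adj u v ∧ (c s(u, v) = α ∨ c s(u, v) = β)
  symm := ⟨fun u v h => ⟨h.1.symm, by rw [Sym2.eq_swap]; exact h.2⟩⟩
  loopless := ⟨fun u h => h.1.ne rfl⟩

open Classical in
/-- Interchange `α` and `β` on the Kempe component of `z`. -/
noncomputable def kempeSwap (G : SimpleGraph V) (c : Sym2 V → K) (α β : K) (z : V) (e : Sym2 V) :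
    K :=
  if ∃ v ∈ e, (G.kempe c α β).Reachable z v then Equiv.swap α β (c e) else c e

-- An edge with only one end in the component has neither color, so the swap fixes it and testing
-- either end is enough.
open Classical in
theorem kempeSwap_of_adj {u v : V} (h : G.Adj u v) :
    G.kempeSwap c α β z s(u, v) =
      if (G.kempe c α β).Reachable z u then Equiv.swap α β (c s(u, v)) else c s(u, v) := by
  unfold kempeSwap
  by_cases hu : (G.kempe c α β).Reachable z u
  · rw [if_pos ⟨u, Sym2.mem_mk_left _ _, hu⟩, if_pos hu]
  · rw [if_neg hu]
    split_ifs with hex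
    · obtain ⟨w, hw, hzw⟩ := hex
      rcases Sym2.mem_iff.1 hw with rfl | rfl
      · exact (hu hzw).elim
      · have hnot : ¬ (c s(u, w) = α ∨ c s(u, w) = β) := fun h' =>
          hu (hzw.trans (Adj.reachable (show (G.kempe c α β).Adj u w from ⟨h, h'⟩)).symm)
        push Not at hnot
        exact Equiv.swap_apply_of_ne_of_ne hnot.1 hnot.2
    · rfl

theorem IsEdgeProper.kempeSwap (hc : G.IsEdgeProper c) :
    G.IsEdgeProper (G.kempeSwap c α β z) := by
  classical
  intro u v w huv huw h
  rw [kempeSwap_of_adj huv, kempeSwap_of_adj huw] at h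
  split_ifs at h
  · exact hc _ _ _ huv huw ((Equiv.swap α β).injective h)
  · exact hc _ _ _ huv huw h

open Classical in
theorem mem_missing_kempeSwap {u : V} {γ : K} :
    γ ∈ G.missing (G.kempeSwap c α β z) u ↔
      (if (G.kempe c α β).Reachable z u then Equiv.swap α β γ else γ) ∈ G.missing c u := by
  refine forall₂_congr fun w huw => not_congr ?_
  rw [kempeSwap_of_adj huw]
  split_ifs
  · exact Equiv.swap_apply_eq_iff
  · rfl

/-- If `α` is missing at `x` and `β` is missing at the vertex `z` of the multifan, then `x` and `z`
are joined by an `α`-`β`-chain. -/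
theorem kempe_reachable_of_mem_fanLayer
    (hno : ∀ c : Sym2 V → K, G.IsEdgeProper c → Disjoint (G.missing c x) (G.missing c y))
    (hc : G.IsEdgeProper c) (hα : α ∈ G.missing c x)
    (n : ℕ) : ∀ z ∈ G.fanLayer c x y n, β ∈ G.missing c z → (G.kempe c α β).Reachable z x := by
  classical
  induction n using Nat.strong_induction_on with
  | _ n ih =>
    intro z hz hβ
    by_contra hzx
    have hlayer : ∀ m ≤ n, G.fanLayer c x y m ⊆ G.fanLayer (G.kempeSwap c α β z) x y m := by
      intro m
      induction m with
      | zero => exact fun _ => subset_rfl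
      | succ m ihm =>
        rintro hm a ⟨hxa, b, hb, hab⟩
        refine ⟨hxa, b, ihm (by omega) hb, ?_⟩
        rw [kempeSwap_of_adj hxa, if_neg hzx, mem_missing_kempeSwap]
        split_ifs with hzb
        -- If `xa` had color `β`, then `b` would miss `β`, and by induction the chain through `z`
        -- and `b` would reach `x`.
        · rw [Equiv.swap_apply_of_ne_of_ne (hα a hxa)]
          · exact hab
          · intro h
            rw [h] at hab
            exact hzx (hzb.trans (ih m (by omega) b hb hab))
        · exact hab
    refine Set.disjoint_left.1 (disjoint_missing_fanLayer hno n _ hc.kempeSwap z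
      (hlayer n le_rfl hz)) (?_ : α ∈ _) ?_
    · rw [mem_missing_kempeSwap, if_neg hzx]; exact hα
    · rw [mem_missing_kempeSwap, if_pos (Reachable.refl z), Equiv.swap_apply_left]; exact hβ

end Fan

/-- In a graph of maximum degree at most two, no component has three vertices of degree at most
one. -/
theorem not_reachable_of_degree_le {V : Type*} [Fintype V] (G : SimpleGraph V)
    [DecidableRel G.Adj] (h2 : ∀ v, G.degree v ≤ 2) {a b d : V} (hab : a ≠ b) (had : a ≠ d)
    (hbd : b ≠ d) (ha : G.degree a ≤ 1) (hb : G.degree b ≤ 1) (hd : G.degree d ≤ 1)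
    (hra : G.Reachable b a) : ¬ G.Reachable d a := by
  classical
  intro hrd
  set C := G.connectedComponentMk a
  have hconn : C.toSimpleGraph.Connected := C.connected_toSimpleGraph
  -- Connectedness on `n` vertices forces degree sum at least `2n - 2`; three vertices of degree at
  -- most one would leave at most `2n - 3`.
  have hcard := hconn.card_vert_le_card_edgeSet_add_one
  have hmem : ∀ v, G.Reachable v a → v ∈ C := fun v hv => ConnectedComponent.sound hv
  have hsum := C.toSimpleGraph.sum_degrees_eq_twice_card_edges
  have hdeg : ∀ v : C, C.toSimpleGraph.degree v ≤ G.degree v := by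
    intro v
    rw [← card_neighborFinset_eq_degree, ← card_neighborFinset_eq_degree]
    refine Finset.card_le_card_of_injOn Subtype.val ?_ (Subtype.val_injective.injOn)
    intro w hw
    simp only [Finset.mem_coe, mem_neighborFinset] at hw ⊢
    exact hw
  let s : Finset C := {⟨a, hmem a (Reachable.refl a)⟩, ⟨b, hmem b hra⟩, ⟨d, hmem d hrd⟩}
  have hs : s.card = 3 := by
    refine Finset.card_eq_three.2 ⟨_, _, _, ?_, ?_, ?_, rfl⟩ <;> simpa [Subtype.ext_iff]
  have hle : ∀ v : C, C.toSimpleGraph.degree v + (if v ∈ s then 1 else 0) ≤ 2 := by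
    intro v
    split_ifs with hv
    · have : G.degree v ≤ 1 := by
        simp only [s, Finset.mem_insert, Finset.mem_singleton] at hv
        rcases hv with rfl | rfl | rfl <;> assumption
      have := hdeg v
      omega
    · exact (hdeg v).trans (h2 v)
  have := Finset.sum_le_sum fun v (_ : v ∈ (Finset.univ : Finset C)) => hle v
  rw [Finset.sum_add_distrib, hsum] at this
  simp only [Finset.sum_ite_mem, Finset.univ_inter, Finset.sum_const, smul_eq_mul, mul_one, hs,
    Finset.card_univ] at this
  rw [Nat.card_eq_fintype_card, Nat.card_eq_fintype_card, ← edgeFinset_card] at hcard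
  omega

/-! ### Counting colors on a multifan -/

section VizingAdjacency

open Finset

variable {V K : Type*} [Fintype V] {G : SimpleGraph V} {c : Sym2 V → K} {x y z : V}
  {α β : K}

theorem degree_kempe_le_card [DecidableEq K] [DecidableRel (G.kempe c α β).Adj]
    (hc : G.IsEdgeProper c) (v : V) (s : Finset K)
    (hs : ∀ w, (G.kempe c α β).Adj v w → c s(v, w) ∈ s) : (G.kempe c α β).degree v ≤ #s := by
  rw [← card_neighborFinset_eq_degree]
  refine card_le_card_of_injOn (fun w => c s(v, w)) ?_ ?_
  · intro w hw
    exact hs w (by simpa using hw)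
  · intro a ha b hb h
    simp only [coe_neighborFinset, mem_neighborSet] at ha hb
    exact hc v a b ha.1 hb.1 h

/-- The missing-color sets of two vertices of a multifan are disjoint. -/
theorem disjoint_missing_of_mem_fanLayer
    (hno : ∀ c : Sym2 V → K, G.IsEdgeProper c → Disjoint (G.missing c x) (G.missing c y))
    (hc : G.IsEdgeProper c) (hxy : x ≠ y) (hα : (G.missing c x).Nonempty) {m n : ℕ} {a b : V}
    (ha : a ∈ G.fanLayer c x y m) (hb : b ∈ G.fanLayer c x y n) (hab : a ≠ b) :
    Disjoint (G.missing c a) (G.missing c b) := by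
  classical
  obtain ⟨α, hα⟩ := hα
  rw [Set.disjoint_left]
  intro β hβa hβb
  have hne : ∀ {n : ℕ} {a : V}, a ∈ G.fanLayer c x y n → x ≠ a := by
    rintro (_ | n) a ha
    · rw [Set.mem_singleton_iff.1 ha]; exact hxy
    · exact ha.1.ne
  have key : ∀ v, β ∈ G.missing c v → (G.kempe c α β).degree v ≤ 1 := fun v hv =>
    degree_kempe_le_card hc v {α} fun w hw => by
      rcases hw.2 with h | h
      · simpa using h
      · exact (hv w hw.1 h).elim
  -- Otherwise `x`, `a` and `b` would be three ends of a single `α`-`β`-chain.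
  refine not_reachable_of_degree_le (G.kempe c α β) ?_ (hne ha) (hne hb) hab ?_ (key a hβa)
    (key b hβb) (kempe_reachable_of_mem_fanLayer hno hc hα m a ha hβa)
    (kempe_reachable_of_mem_fanLayer hno hc hα n b hb hβb)
  · intro v
    exact (degree_kempe_le_card hc v {α, β} fun w hw => by simpa using hw.2).trans card_le_two
  · refine degree_kempe_le_card hc x {β} fun w hw => ?_
    rcases hw.2 with h | h
    · exact (hα w hw.1 h).elim
    · simpa using h

variable [Fintype K]

theorem ncard_missing_add_degree [DecidableRel G.Adj] (hc : G.IsEdgeProper c) (v : V) :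
    (G.missing c v).ncard + G.degree v = Fintype.card K := by
  classical
  have h1 : G.missing c v = ↑((G.neighborFinset v).image fun w => c s(v, w))ᶜ := by
    ext a
    simp [missing]
  have h2 : ((G.neighborFinset v).image fun w => c s(v, w)).card = G.degree v := by
    rw [card_image_of_injOn, card_neighborFinset_eq_degree]
    intro a ha b hb h
    exact hc v a b (by simpa using ha) (by simpa using hb) h
  rw [h1, Set.ncard_coe_finset, card_compl, h2]
  have := h2 ▸ card_le_univ ((G.neighborFinset v).image fun w => c s(v, w))
  omega

/-- The colors from `x` to the fan vertices `R` other than `y` are exactly those missing at `y` or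
on `R`. By disjointness `#R` is the sum of the numbers of missing colors. Each vertex of `R` not of
full degree accounts for at least one, so the full-degree ones must make up for those missing at
`y`. -/
theorem card_sub_degree_le_of_disjoint_missing [DecidableRel G.Adj]
    (hno : ∀ c : Sym2 V → K, G.IsEdgeProper c → Disjoint (G.missing c x) (G.missing c y))
    (hc : G.IsEdgeProper c) (hxy : x ≠ y) (hadj : ¬ G.Adj x y)
    (hα : (G.missing c x).Nonempty) :
    Fintype.card K - G.degree y ≤ #{b ∈ G.neighborFinset x | G.degree b = Fintype.card K} := by
  classical
  set R : Finset V := {b | b ≠ y ∧ ∃ n, b ∈ G.fanLayer c x y n} with hR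
  have hyR : y ∉ R := by simp [hR]
  have hRmem : ∀ b ∈ insert y R, ∃ n, b ∈ G.fanLayer c x y n := by
    intro b hb
    rcases mem_insert.1 hb with rfl | hb
    · exact ⟨0, rfl⟩
    · exact (mem_filter.1 hb).2.2
  have hRadj : ∀ b ∈ R, G.Adj x b := by
    intro b hb
    obtain ⟨-, hby, n, hn⟩ := mem_filter.1 hb
    cases n with
    | zero => exact (hby hn).elim
    | succ n => exact hn.1
  let M : V → Finset K := fun v => {a | a ∈ G.missing c v}
  have hM : ∀ v, #(M v) + G.degree v = Fintype.card K := by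
    intro v
    rw [← ncard_missing_add_degree hc v, ← Set.ncard_coe_finset]
    simp [M]
  have himage : R.image (fun b => c s(x, b)) = (insert y R).biUnion M := by
    ext γ
    simp only [mem_image, mem_biUnion]
    constructor
    · rintro ⟨b, hb, rfl⟩
      obtain ⟨-, hby, n, hn⟩ := mem_filter.1 hb
      cases n with
      | zero => exact (hby hn).elim
      | succ n =>
        obtain ⟨-, a, ha, hab⟩ := hn
        refine ⟨a, ?_, by simpa [M] using hab⟩
        by_cases hay : a = y
        · simp [hay]
        · exact mem_insert_of_mem (mem_filter.2 ⟨mem_univ _, hay, n, ha⟩)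
    · rintro ⟨b, hb, hγ⟩
      obtain ⟨n, hn⟩ := hRmem b hb
      have hγ : γ ∈ G.missing c b := by simpa [M] using hγ
      have hγx : γ ∉ G.missing c x := fun h =>
        Set.disjoint_left.1 (disjoint_missing_fanLayer hno n c hc b hn) h hγ
      simp only [missing, Set.mem_ofPred_eq, not_forall, not_not] at hγx
      obtain ⟨a, hxa, rfl⟩ := hγx
      refine ⟨a, mem_filter.2 ⟨mem_univ _, ?_, n + 1, hxa, b, hn, hγ⟩, rfl⟩
      rintro rfl
      exact hadj hxa
  have hcard := congrArg card himage
  rw [card_image_of_injOn fun a ha b hb h => hc x a b (hRadj a ha) (hRadj b hb) h,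
    card_biUnion, sum_insert hyR] at hcard
  · have hsum : #R ≤ ∑ b ∈ R, #(M b) + #{b ∈ R | G.degree b = Fintype.card K} := by
      rw [card_filter _ R, ← sum_add_distrib, card_eq_sum_ones]
      refine sum_le_sum fun b _ => ?_
      have := hM b
      split_ifs <;> omega
    have hsub : #{b ∈ R | G.degree b = Fintype.card K} ≤
        #{b ∈ G.neighborFinset x | G.degree b = Fintype.card K} :=
      card_le_card (filter_subset_filter _ fun b hb => by simpa using hRadj b hb)
    have := hM y
    omega
  · intro a ha b hb hab
    obtain ⟨m, hm⟩ := hRmem a ha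
    obtain ⟨n, hn⟩ := hRmem b hb
    change Disjoint (M a) (M b)
    rw [← disjoint_coe]
    simpa [M] using disjoint_missing_of_mem_fanLayer hno hc hxy hα hm hn hab

end VizingAdjacency

/-! ### Critical graphs: adjacency lemma and discharging -/

section Critical

open Finset

/-- **Vizing's adjacency lemma** for a graph that is edge-minimal among those without a proper
edge-coloring with colors in `K`. -/
theorem vizing_adjacency {V K : Type*} [Fintype V] [DecidableEq V] [Fintype K]
    {H : SimpleGraph V} [DecidableRel H.Adj]
    (hH : ∀ c : Sym2 V → K, ¬ H.IsEdgeProper c)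
    (hmin : ∀ H' < H, ∃ c : Sym2 V → K, H'.IsEdgeProper c)
    (hdeg : ∀ v, H.degree v ≤ Fintype.card K) {x y : V} (hxy : H.Adj x y) :
    Fintype.card K + 1 ≤
      H.degree y + #{b ∈ (H.neighborFinset x).erase y | H.degree b = Fintype.card K} := by
  set G := H.deleteEdges {s(x, y)} with hG
  have hadj : ∀ u v, G.Adj u v ↔ H.Adj u v ∧ s(u, v) ≠ s(x, y) := fun u v => by
    rw [hG, deleteEdges_adj, Set.mem_singleton_iff]
  have hlt : G < H := by
    refine lt_of_le_of_ne (deleteEdges_le _) fun h => ?_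
    rw [← h] at hxy
    exact ((hadj x y).1 hxy).2 rfl
  obtain ⟨c, hc⟩ := hmin G hlt
  have hno : ∀ c : Sym2 V → K, G.IsEdgeProper c →
      Disjoint (G.missing c x) (G.missing c y) := by
    intro c hc
    rw [Set.disjoint_left]
    intro α hx hy
    exact hH _ (hc.update (fun u v h h' => (hadj u v).2 ⟨h, h'⟩) hx hy)
  have hNx : G.neighborFinset x = (H.neighborFinset x).erase y := by
    ext w
    simp only [mem_neighborFinset, hadj, mem_erase, Sym2.congr_right, ne_eq]
    tauto
  have hNy : G.neighborFinset y = (H.neighborFinset y).erase x := by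
    ext w
    simp only [mem_neighborFinset, hadj, mem_erase, Sym2.eq_swap (a := x), Sym2.congr_right, ne_eq]
    tauto
  have hN : ∀ b, b ≠ x → b ≠ y → G.degree b = H.degree b := by
    intro b hbx hby
    rw [← card_neighborFinset_eq_degree, ← card_neighborFinset_eq_degree]
    congr 1
    ext w
    simp only [mem_neighborFinset, hadj, ne_eq, Sym2.eq_iff]
    tauto
  have hdx : G.degree x + 1 = H.degree x := by
    rw [← card_neighborFinset_eq_degree, hNx, card_erase_add_one (by simpa using hxy),
      card_neighborFinset_eq_degree]
  have hdy : G.degree y + 1 = H.degree y := by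
    rw [← card_neighborFinset_eq_degree, hNy, card_erase_add_one (by simpa using hxy.symm),
      card_neighborFinset_eq_degree]
  -- Deleting `xy` leaves `x` with degree below the number of colors.
  have hα : (G.missing c x).Nonempty := by
    rw [← Set.ncard_pos]
    have := ncard_missing_add_degree hc x
    have := hdeg x
    omega
  have := card_sub_degree_le_of_disjoint_missing hno hc hxy.ne
    (fun h => ((hadj x y).1 h).2 rfl) hα
  rw [hNx] at this
  have hfilter : ((H.neighborFinset x).erase y).filter (fun b => G.degree b = Fintype.card K) =
      ((H.neighborFinset x).erase y).filter (fun b => H.degree b = Fintype.card K) := by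
    refine filter_congr fun b hb => ?_
    rw [mem_erase, mem_neighborFinset] at hb
    rw [hN b hb.2.ne' hb.1]
  rw [hfilter] at this
  omega

/-- The charge sent from a vertex of degree `e` to a neighbor of degree `d`. -/
def dischargeAmount (k e d : ℕ) : ℚ :=
  if d ≤ 5 then
    if e = k then (k - 6) / (d - 1) else if e = 7 ∧ k = 8 then 1 / (d - 2) else 0
  else 0

theorem dischargeAmount_nonneg {k e d : ℕ} (hk : 8 ≤ k) (hd : 2 ≤ d) :
    0 ≤ dischargeAmount k e d := by
  have hk' : (8 : ℚ) ≤ k := by exact_mod_cast hk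
  have hd' : (2 : ℚ) ≤ d := by exact_mod_cast hd
  unfold dischargeAmount
  split_ifs with h1 h2 h3
  · exact div_nonneg (by linarith) (by linarith)
  · exact div_nonneg (by norm_num) (by linarith)
  · rfl
  · rfl

/-- Vizing's adjacency lemma with at least eight colors forces average degree at least six on the
non-isolated vertices. -/
theorem six_mul_card_le_sum_degree {V : Type*} [Fintype V] [DecidableEq V] (H : SimpleGraph V)
    [DecidableRel H.Adj] {k : ℕ} (hk : 8 ≤ k) (hdeg : ∀ v, H.degree v ≤ k)
    (hval : ∀ x y, H.Adj x y →
      k + 1 ≤ H.degree y + #{b ∈ (H.neighborFinset x).erase y | H.degree b = k}) :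
    6 * #{v | 0 < H.degree v} ≤ ∑ v, H.degree v := by
  have hkQ : (8 : ℚ) ≤ k := by exact_mod_cast hk
  set f : V → V → ℚ := fun v u => dischargeAmount k (H.degree v) (H.degree u) with hf
  have htop : ∀ x y, H.Adj x y → k + 1 ≤ H.degree y + #{b ∈ H.neighborFinset x | H.degree b = k} :=
    fun x y h => (hval x y h).trans (Nat.add_le_add_left (card_le_card
      (filter_subset_filter _ (erase_subset _ _))) _)
  have htop2 : ∀ x, 0 < H.degree x → 2 ≤ #{b ∈ H.neighborFinset x | H.degree b = k} := by
    intro x hx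
    obtain ⟨y, hy⟩ := (H.degree_pos_iff_exists_adj x).1 hx
    have h1 : 0 < #{b ∈ H.neighborFinset x | H.degree b = k} := by
      have := htop x y hy
      have := hdeg y
      omega
    obtain ⟨z, hz⟩ := card_pos.1 h1
    have hz' := (mem_filter.1 hz)
    have hxz : H.Adj x z := by simpa using hz'.1
    -- Applied to a neighbor `z` of degree `k`, adjacency yields a second one.
    have h2 := hval x z hxz
    rw [filter_erase, card_erase_of_mem hz] at h2
    have := hdeg z
    omega
  have hle : ∀ x, #{b ∈ H.neighborFinset x | H.degree b = k} ≤ H.degree x := fun x =>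
    (card_filter_le _ _).trans_eq (H.card_neighborFinset_eq_degree x)
  have hnbr : ∀ x y, H.Adj x y → H.degree y ≠ k →
      k + 2 ≤ H.degree y + H.degree x := by
    intro x y hxy hy
    have h1 := htop x y hxy
    have h2 : #{b ∈ H.neighborFinset x | H.degree b = k} < #(H.neighborFinset x) :=
      card_lt_card (filter_ssubset.2 ⟨y, by simpa using hxy, hy⟩)
    rw [H.card_neighborFinset_eq_degree x] at h2
    omega
  have hpos : ∀ x y, H.Adj x y → 2 ≤ H.degree x := fun x y h =>
    (htop2 x ((H.degree_pos_iff_exists_adj x).2 ⟨y, h⟩)).trans (hle x)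
  have hf0 : ∀ v u, H.Adj v u → 0 ≤ f v u := fun v u h =>
    dischargeAmount_nonneg hk (hpos u v h.symm)
  have hlow : ∀ v, ∀ m : ℕ, (∃ u, H.Adj v u ∧ H.degree u = m) →
      #{u ∈ H.neighborFinset v | H.degree u ≤ 5} + (k + 1) ≤ H.degree v + m := by
    rintro v m ⟨u, hvu, rfl⟩
    have h1 := htop v u hvu
    have h2 : #{u ∈ H.neighborFinset v | H.degree u ≤ 5} +
        #{b ∈ H.neighborFinset v | H.degree b = k} ≤ #(H.neighborFinset v) := by
      rw [← card_union_of_disjoint]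
      · exact card_le_card (union_subset (filter_subset _ _) (filter_subset _ _))
      · refine disjoint_filter.2 fun b _ hb => ?_
        omega
    rw [H.card_neighborFinset_eq_degree v] at h2
    omega
  have hgive : ∀ v, 6 ≤ H.degree v → ∑ u ∈ H.neighborFinset v, f v u ≤ (H.degree v : ℚ) - 6 := by
    intro v hv
    have hvQ : (6 : ℚ) ≤ H.degree v := by exact_mod_cast hv
    have hsum : ∑ u ∈ H.neighborFinset v, f v u =
        ∑ u ∈ H.neighborFinset v with H.degree u ≤ 5, f v u := by
      rw [sum_filter]
      refine sum_congr rfl fun u _ => ?_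
      by_cases h : H.degree u ≤ 5
      · rw [if_pos h]
      · simp only [hf, dischargeAmount, if_neg h]
    rw [hsum]
    rcases ({u ∈ H.neighborFinset v | H.degree u ≤ 5} : Finset V).eq_empty_or_nonempty with h0 | h0
    · rw [h0, sum_empty]; linarith
    -- The least degree among small neighbors bounds both their number (`hlow`) and each gift: at
    -- most `d(w) - 1` gifts of `(k - 6)/(d(w) - 1)`, or, from degree 7, `d(w) - 2` gifts of
    -- `1/(d(w) - 2)`.
    obtain ⟨w, hw, hwmin⟩ := exists_min_image _ (fun u => H.degree u) h0
    obtain ⟨hvw, hw5⟩ := mem_filter.1 hw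
    rw [mem_neighborFinset] at hvw
    have hcard := hlow v _ ⟨w, hvw, rfl⟩
    have hw2 := hpos w v hvw.symm
    have hpos' := card_pos.2 h0
    generalize hA : ({u ∈ H.neighborFinset v | H.degree u ≤ 5} : Finset V) = A at *
    have hA5 : ∀ u ∈ A, H.degree u ≤ 5 := fun u hu => by
      rw [← hA] at hu; exact (mem_filter.1 hu).2
    by_cases hvk : H.degree v = k
    · have h1 : ∀ u ∈ A, f v u ≤ ((k : ℚ) - 6) / (H.degree w - 1) := by
        intro u hu
        simp only [hf, dischargeAmount, if_pos (hA5 u hu), if_pos hvk]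
        have : (H.degree w : ℚ) ≤ H.degree u := by exact_mod_cast hwmin u hu
        have : (2 : ℚ) ≤ H.degree w := by exact_mod_cast hw2
        exact div_le_div_of_nonneg_left (by linarith) (by linarith) (by linarith)
      refine (sum_le_card_nsmul _ _ _ h1).trans ?_
      have h3 : (#A : ℚ) ≤ H.degree w - 1 := by
        have : #A + 1 ≤ H.degree w := by omega
        have : (#A : ℚ) + 1 ≤ H.degree w := by exact_mod_cast this
        linarith
      have h4 : (0 : ℚ) < H.degree w - 1 := by
        have : (2 : ℚ) ≤ H.degree w := by exact_mod_cast hw2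
        linarith
      rw [nsmul_eq_mul, mul_div_assoc', div_le_iff₀ h4, hvk, mul_comm]
      exact mul_le_mul_of_nonneg_left h3 (by linarith)
    by_cases hv7 : H.degree v = 7 ∧ k = 8
    · have hw3 : 3 ≤ H.degree w := by omega
      have hw3Q : (3 : ℚ) ≤ H.degree w := by exact_mod_cast hw3
      have h1 : ∀ u ∈ A, f v u ≤ 1 / ((H.degree w : ℚ) - 2) := by
        intro u hu
        simp only [hf, dischargeAmount, if_pos (hA5 u hu), if_neg hvk, if_pos hv7]
        have : (H.degree w : ℚ) ≤ H.degree u := by exact_mod_cast hwmin u hu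
        exact div_le_div_of_nonneg_left (by linarith) (by linarith) (by linarith)
      refine (sum_le_card_nsmul _ _ _ h1).trans ?_
      have h3 : (#A : ℚ) ≤ H.degree w - 2 := by
        have : #A + 2 ≤ H.degree w := by omega
        have : (#A : ℚ) + 2 ≤ H.degree w := by exact_mod_cast this
        linarith
      rw [nsmul_eq_mul, mul_div_assoc', div_le_iff₀ (by linarith), hv7.1]
      push_cast
      linarith
    · refine (sum_nonpos fun u hu => ?_).trans (by linarith)
      simp only [hf, dischargeAmount, if_pos (hA5 u hu), if_neg hvk, if_neg hv7, le_refl]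
  have htake : ∀ v, 0 < H.degree v → H.degree v ≤ 5 →
      6 - (H.degree v : ℚ) ≤ ∑ u ∈ H.neighborFinset v, f u v := by
    intro v hv0 hv5
    have h2 := htop2 v hv0
    have hd2 := h2.trans (hle v)
    have hcardN := H.card_neighborFinset_eq_degree v
    have hfk : ∀ u, H.degree u = k → f u v = ((k : ℚ) - 6) / (H.degree v - 1) := fun u hu => by
      simp only [hf, dischargeAmount, if_pos hv5, if_pos hu]
    have hbig : ∀ t : ℕ, t ≤ #{b ∈ H.neighborFinset v | H.degree b = k} →
        t * (((k : ℚ) - 6) / (H.degree v - 1)) ≤ ∑ u ∈ H.neighborFinset v, f u v := by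
      intro t ht
      calc t * (((k : ℚ) - 6) / (H.degree v - 1))
          ≤ #{b ∈ H.neighborFinset v | H.degree b = k} * (((k : ℚ) - 6) / (H.degree v - 1)) := by
            refine mul_le_mul_of_nonneg_right (by exact_mod_cast ht) (div_nonneg (by linarith) ?_)
            have : (2 : ℚ) ≤ H.degree v := by exact_mod_cast hd2
            linarith
        _ = ∑ u ∈ H.neighborFinset v with H.degree u = k, f u v := by
            rw [sum_congr rfl fun u hu => hfk u (mem_filter.1 hu).2, sum_const, nsmul_eq_mul]
        _ ≤ _ := sum_le_sum_of_subset_of_nonneg (filter_subset _ _) fun u hu _ =>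
            hf0 u v (by simpa [adj_comm] using hu)
    have hall : ∀ r : ℚ, (∀ u, H.Adj v u → r ≤ f u v) →
        H.degree v * r ≤ ∑ u ∈ H.neighborFinset v, f u v := by
      intro r hr
      rw [← hcardN, ← nsmul_eq_mul]
      exact card_nsmul_le_sum _ _ _ fun u hu => hr u (by simpa using hu)
    have hbig2 := hbig 2 h2
    have h25 : H.degree v = 2 ∨ H.degree v = 3 ∨ H.degree v = 4 ∨ H.degree v = 5 := by omega
    have hk89 : k = 8 ∨ (9 : ℚ) ≤ k := by
      rcases hk.eq_or_lt with h | h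
      · exact Or.inl h.symm
      · exact Or.inr (by exact_mod_cast h)
    -- Two neighbors of degree `k` suffice except for degrees 3 and 4 with `k = 8`. There `hnbr`
    -- excludes low-degree neighbors; a neighbor of degree 6 forces three of degree 8, and otherwise
    -- every neighbor gives.
    rcases h25 with h | h | h | h <;> rw [h] at hbig2 <;> rw [h]
    · norm_num at hbig2 ⊢; linarith
    · rcases hk89 with rfl | hk9
      · refine le_trans ?_ (hall 1 fun u hu => ?_)
        · rw [h]; norm_num
        have h7 : H.degree u = 8 ∨ H.degree u = 7 := by
          have := hnbr v u hu
          have := hdeg u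
          omega
        rcases h7 with h7 | h7 <;> simp only [hf, dischargeAmount, h7, h] <;> norm_num
      · norm_num at hbig2 ⊢; linarith
    · rcases hk89 with rfl | hk9
      · by_cases h6 : ∃ u, H.Adj v u ∧ H.degree u = 6
        · obtain ⟨u, hu, hu6⟩ := h6
          have := htop v u hu
          have h3 := hbig 3 (by omega)
          rw [h] at h3
          norm_num at h3 ⊢; linarith
        · refine le_trans ?_ (hall (1 / 2) fun u hu => ?_)
          · rw [h]; norm_num
          have h7 : H.degree u = 8 ∨ H.degree u = 7 := by
            have := hnbr v u hu
            have := hdeg u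
            have : H.degree u ≠ 6 := fun h => h6 ⟨u, hu, h⟩
            omega
          rcases h7 with h7 | h7 <;> simp only [hf, dischargeAmount, h7, h] <;> norm_num
      · norm_num at hbig2 ⊢; linarith
    · norm_num at hbig2 ⊢; linarith
  have hswap : ∑ v, ∑ u ∈ H.neighborFinset v, f v u = ∑ v, ∑ u ∈ H.neighborFinset v, f u v :=
    sum_comm' fun v u => by simp [adj_comm]
  have hvertex : ∀ v, (6 : ℚ) * (if 0 < H.degree v then 1 else 0) +
      ∑ u ∈ H.neighborFinset v, f v u ≤ H.degree v + ∑ u ∈ H.neighborFinset v, f u v := by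
    intro v
    have hin : 0 ≤ ∑ u ∈ H.neighborFinset v, f u v :=
      sum_nonneg fun u hu => hf0 u v (by simpa [adj_comm] using hu)
    by_cases h6 : 6 ≤ H.degree v
    · rw [if_pos (by omega)]
      linarith [hgive v h6]
    · have hout : ∑ u ∈ H.neighborFinset v, f v u = 0 := by
        refine sum_eq_zero fun u _ => ?_
        have h1 : H.degree v ≠ k := by omega
        have h7 : ¬ (H.degree v = 7 ∧ k = 8) := by omega
        simp only [hf, dischargeAmount, if_neg h1, if_neg h7, ite_self]
      rw [hout]
      split_ifs with h0
      · linarith [htake v h0 (by omega)]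
      · have : (0 : ℚ) ≤ H.degree v := Nat.cast_nonneg _
        linarith
  have htotal := sum_le_sum fun v (_ : v ∈ univ) => hvertex v
  rw [sum_add_distrib, sum_add_distrib, hswap, add_le_add_iff_right, ← mul_sum, sum_boole] at htotal
  exact_mod_cast htotal

end Critical

/-! ### From edge-minimal subgraphs to the edge-chromatic number -/

section Main

open Finset

/-- A graph on a finite vertex set with `mad(G) < 6` has a proper edge-coloring with `k` colors for
every `k ≥ 8` that bounds its vertex degrees. -/
theorem exists_isEdgeProper_of_mad_lt_six {V : Type*} [Fintype V] (G : SimpleGraph V)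
    [DecidableRel G.Adj] (hmad : G.mad < 6) {k : ℕ} (hk : 8 ≤ k) (hdeg : ∀ v, G.degree v ≤ k) :
    ∃ c : Sym2 V → Fin k, G.IsEdgeProper c := by
  classical
  by_contra hG
  obtain ⟨H, hHG, hH⟩ := exists_minimal_le_of_wellFoundedLT
    (fun H : SimpleGraph V => ¬ ∃ c : Sym2 V → Fin k, H.IsEdgeProper c) G hG
  have hno : ∀ c : Sym2 V → Fin k, ¬ H.IsEdgeProper c := not_exists.1 hH.prop
  have hmin : ∀ H' < H, ∃ c : Sym2 V → Fin k, H'.IsEdgeProper c := fun H' h =>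
    not_not.1 (hH.not_prop_of_lt h)
  have hdegH : ∀ v, H.degree v ≤ k := fun v => (degree_le_of_le hHG).trans (hdeg v)
  have hcount := six_mul_card_le_sum_degree H hk hdegH fun x y hxy => by
    simpa using vizing_adjacency hno hmin (by simpa using hdegH) hxy
  rw [H.sum_degrees_eq_twice_card_edges] at hcount
  -- Isolated vertices of `H` are dropped, since they would lower the average degree.
  let S : G.Subgraph :=
    { verts := {v | 0 < H.degree v}
      Adj := H.Adj
      adj_sub := fun h => hHG h
      edge_vert := fun h => (H.degree_pos_iff_exists_adj _).2 ⟨_, h⟩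
      symm := H.symm }
  have hverts : S.verts.ncard = #{v | 0 < H.degree v} := by
    rw [← Set.ncard_coe_finset]
    simp [S]
  have hedges : S.edgeSet.ncard = #H.edgeFinset := by
    rw [← Set.ncard_coe_finset, coe_edgeFinset]
    rfl
  have hne : S.verts.Nonempty := by
    by_contra hemp
    refine hno (fun _ => ⟨0, by omega⟩) fun u v w huv _ _ => ?_
    exact (hemp ⟨u, S.edge_vert huv⟩).elim
  obtain ⟨v, -⟩ := id hne
  have : Nonempty V := ⟨v⟩
  have hle := (isGreatest_mad G).2 ⟨S, hne, rfl⟩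
  have hpos : (0 : ℝ) < S.verts.ncard := by exact_mod_cast (Set.ncard_pos).2 hne
  have hlt := hle.trans_lt hmad
  rw [div_lt_iff₀ hpos, hverts, hedges] at hlt
  have : 2 * #H.edgeFinset < 6 * #{v | 0 < H.degree v} := by exact_mod_cast hlt
  omega

theorem maxDegree_le_of_isProperEdgeColoring {V : Type*} [Fintype V] (G : SimpleGraph V)
    [DecidableRel G.Adj] {k : ℕ} (c : G.EdgeLabeling (Fin k)) (hc : IsProperEdgeColoring c) :
    G.maxDegree ≤ k := by
  refine G.maxDegree_le_of_forall_degree_le k fun v => ?_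
  rw [← card_neighborSet_eq_degree]
  conv_rhs => rw [← Fintype.card_fin k]
  refine Fintype.card_le_of_injective
    (fun w : G.neighborSet v => c ⟨s(v, w), w.2⟩) fun a b hab => ?_
  by_contra hne
  refine hc ⟨s(v, a), a.2⟩ ⟨s(v, b), b.2⟩ ?_ ⟨v, Sym2.mem_mk_left _ _, Sym2.mem_mk_left _ _⟩ hab
  intro h
  exact hne (Subtype.ext (Sym2.congr_right.1 (Subtype.ext_iff.1 h)))

theorem IsEdgeProper.isProperEdgeColoring {V K : Type*} {G : SimpleGraph V} {c : Sym2 V → K}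
    (hc : G.IsEdgeProper c) :
    IsProperEdgeColoring (G := G) (fun e : G.edgeSet => c e) := by
  rintro ⟨e, he⟩ ⟨f, hf⟩ hef ⟨v, hve, hvf⟩ h
  obtain ⟨a, rfl⟩ := Sym2.mem_iff_exists.1 hve
  obtain ⟨b, rfl⟩ := Sym2.mem_iff_exists.1 hvf
  exact hef (Subtype.ext (congrArg (fun w => s(v, w)) (hc v a b he hf h)))

end Main

end SimpleGraph

theorem mainTheorem3 {V : Type*} [Fintype V] (G : SimpleGraph V) [DecidableRel G.Adj]
    (hmad : G.mad < 6) (hdeg : 8 ≤ G.maxDegree) :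
    G.edgeChromaticNumber = (G.maxDegree : ℕ∞) := by
  refine le_antisymm (sInf_le ?_) (le_sInf ?_)
  · obtain ⟨c, hc⟩ := G.exists_isEdgeProper_of_mad_lt_six hmad hdeg G.degree_le_maxDegree
    exact ⟨_, rfl, _, hc.isProperEdgeColoring⟩
  · rintro _ ⟨k, rfl, c, hc⟩
    exact_mod_cast G.maxDegree_le_of_isProperEdgeColoring c hc
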